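/- **Setting.** Let $G$ be a $3$-dimensional Lie group with a bi-invariant Riemannian metric $\langle\,,\rangle$, Lie algebra $\mathfrak g=T_1G$ and a fixed orientation of $\mathfrak g$. Vector fields along a curve are written in left-invariant fields, that is, as $\mathfrak g$-valued functions $W$; $\dot W$ is the derivative of the coefficients, and $D_{\alpha'}W=\dot W+\tfrac12[\alpha',W]$ is the covariant derivative along $\alpha$. For a smooth curve $\alpha$ parametrized by arc length on an open interval and with nowhere vanishing curvature, the Frenet apparatus $(T,N,B,\kappa,\tau)$ is given by $$T=\alpha',\quad \kappa=\|D_TT\|>0,\quad D_TT=\kappa N,\quad B=T\times N,\quad \tau=\langle D_TN,B\rangle ,$$ and $\tau_G=\tfrac12\langle[T,N],B\rangle$. The harmonic curvature of $\alpha$ is $H=(\tau-\tau_G)/\kappa$. Two such curves $\alpha=\alpha(s)$, $s\in J$, and $\tilde\alpha=\tilde\alpha(s^*)$, $s^*\in\tilde J$, form a *Bertrand pair*, with respect to a smooth bijection $s\mapsto s^*=h(s)$ from $J$ onto $\tilde J$, if they do not coincide and their principal normal lines at corresponding points are equal. Points and lines are understood in left-invariant coefficients: there are curves $a,\tilde a$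 in $\mathfrak g$ with $\dot a=T$ and $\dot{\tilde a}=\tilde T$ such that $a(s)+\mathbb R N(s)=\tilde a(h(s))+\mathbb R\tilde N(h(s))$ for all $s\in J$, and $a\ne\tilde a\circ h$. **Theorem 3.1.** Let $(\alpha,\tilde\alpha)$ be a Bertrand pair in $G$, with Frenet apparatus $(T,N,B,\kappa,\tau)$ and $(\tilde T,\tilde N,\tilde B,\tilde\kappa,\tilde\tau)$. Then there are constants $\varepsilon,\delta\in\{1,-1\}$ such that $N(s)=\varepsilon\tilde N(h(s))$ for all $s\in J$, and such that for every $s\in J$ with $\tilde\kappa'(s^*)\neq0$, where $s^*=h(s)$, the following holds. Put $$\rho=\frac{(\tilde\tau-\tilde\tau_G)'}{\tilde\kappa'},\qquad \tilde H=\frac{\tilde\tau-\tilde\tau_G}{\tilde\kappa}$$ (derivatives with respect to $s^*$; all quantities of $\tilde\alpha$ are taken at $s^*$, those of $\alpha$ at $s$). Then $$T=\frac{-\delta}{\sqrt{1+\rho^2}}\,(\tilde T-\rho\tilde B),\qquad B=\frac{-\delta\varepsilon}{\sqrt{1+\rho^2}}\,(\rho\tilde T+\tilde B),$$ where $\delta=1$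 if and only if $\langle T,\tilde T\rangle<0$, and, if $\tilde H\neq0$, $$\kappa=\frac{-\varepsilon\tilde\kappa(1+\tilde H\rho)(\rho-\tilde H)}{\tilde H(1+\rho^2)},\qquad \tau-\tau_G=\frac{\tilde\kappa(\rho-\tilde H)^2}{\tilde H(1+\rho^2)},\qquad \frac{ds^*}{ds}=\delta\,\frac{\rho-\tilde H}{\tilde H\sqrt{1+\rho^2}} .$$ -/

import Mathlib

open Set
open scoped Manifold ContDiff

noncomputable section

namespace LieBertrand

variable {G : Type*} [TopologicalSpace G] [ChartedSpace (EuclideanSpace ℝ (Fin 3)) G] [Group G]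

/-- A smooth Riemannian metric on the `3`-dimensional manifold `G`. -/
abbrev Metric (G : Type*) [TopologicalSpace G] [ChartedSpace (EuclideanSpace ℝ (Fin 3)) G]
    [Group G] [LieGroup (𝓡 3) ∞ G] : Type _ :=
  haveI : IsManifold (𝓡 3) ∞ G := inferInstance
  haveI : IsManifold (𝓡 3) 1 G := IsManifold.of_le (n := ∞) (by exact_mod_cast le_top)
  Bundle.ContMDiffRiemannianMetric (𝓡 3) ∞ (EuclideanSpace ℝ (Fin 3))
    (fun x : G => TangentSpace (𝓡 3) x)

/-- The metric is invariant under all left and all right translations. -/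
structure IsBiInvariant [LieGroup (𝓡 3) ∞ G] (g : Metric G) : Prop where
  left : ∀ (a x : G) (v w : TangentSpace (𝓡 3) x),
    g.inner (a * x) (mfderiv (𝓡 3) (𝓡 3) (fun y => a * y) x v)
      (mfderiv (𝓡 3) (𝓡 3) (fun y => a * y) x w) = g.inner x v w
  right : ∀ (a x : G) (v w : TangentSpace (𝓡 3) x),
    g.inner (x * a) (mfderiv (𝓡 3) (𝓡 3) (fun y => y * a) x v)
      (mfderiv (𝓡 3) (𝓡 3) (fun y => y * a) x w) = g.inner x v w

/-- The velocity `α'(s)`, translated from the left to the Lie algebra `T_1 G`: the derivative at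
`t = s` of `t ↦ α(s)⁻¹ α(t)`, a curve that passes through `1` at `t = s`.
Its coefficients are those of `α'(s)` in a basis of left-invariant vector fields. -/
def velocity (α : ℝ → G) (s : ℝ) : GroupLieAlgebra (𝓡 3) G :=
  mfderiv 𝓘(ℝ, ℝ) (𝓡 3) (fun t => (α s)⁻¹ * α t) s (1 : ℝ)

/-- The inner product of the Lie algebra. Vector fields along a curve are given
by their coefficients with respect to left-invariant fields, that is, as functions with values in
the Lie algebra. -/
def ip [LieGroup (𝓡 3) ∞ G] (g : Metric G) (v w : GroupLieAlgebra (𝓡 3) G) : ℝ :=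
  g.inner 1 v w

/-- The covariant derivative `D_{α'} W = Ẇ + (1/2) [α', W]` along `α`, for the Levi-Civita
connection of a bi-invariant metric; `W` is a field along `α`, written in left-invariant fields. -/
def covDeriv (α : ℝ → G) (W : ℝ → GroupLieAlgebra (𝓡 3) G) (s : ℝ) :
    GroupLieAlgebra (𝓡 3) G :=
  deriv W s + (1 / 2 : ℝ) • ⁅velocity α s, W s⁆

/-- `α` is a smooth curve on `J`, parametrized by arc length. -/
structure IsUnitSpeedOn [LieGroup (𝓡 3) ∞ G] (g : Metric G) (J : Set ℝ) (α : ℝ → G) : Prop where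
  smooth : ContMDiffOn 𝓘(ℝ, ℝ) (𝓡 3) ∞ α J
  unit : ∀ s ∈ J, g.inner (α s) (mfderiv 𝓘(ℝ, ℝ) (𝓡 3) α s (1 : ℝ))
    (mfderiv 𝓘(ℝ, ℝ) (𝓡 3) α s (1 : ℝ)) = 1

/-- `(T, N, B, κ, τ)` is the Frenet apparatus on `J` of the arc-length curve `α`, whose curvature
vanishes nowhere: `T = α'`, `κ = ‖D_T T‖`, `D_T T = κ N`, `B = T × N`, `τ = ⟨D_T N, B⟩`.
The cross product is the one of the metric and the orientation `o`, so that `B` is the unit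
vector orthogonal to `T` and `N` for which `(T, N, B)` is a positively oriented basis. -/
structure IsFrenetApparatus [LieGroup (𝓡 3) ∞ G] (g : Metric G)
    (o : Orientation ℝ (GroupLieAlgebra (𝓡 3) G) (Fin 3)) (J : Set ℝ) (α : ℝ → G)
    (T N B : ℝ → GroupLieAlgebra (𝓡 3) G) (κ τ : ℝ → ℝ) : Prop where
  tangent : ∀ s ∈ J, T s = velocity α s
  curvature : ∀ s ∈ J, κ s = Real.sqrt (ip g (covDeriv α T s) (covDeriv α T s))
  curvature_pos : ∀ s ∈ J, 0 < κ s
  normal : ∀ s ∈ J, covDeriv α T s = κ s • N s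
  binormal_unit : ∀ s ∈ J, ip g (B s) (B s) = 1
  binormal_orth : ∀ s ∈ J, ip g (T s) (B s) = 0 ∧ ip g (N s) (B s) = 0
  oriented : ∀ s ∈ J, ∃ b : Module.Basis (Fin 3) ℝ (GroupLieAlgebra (𝓡 3) G),
    (b : Fin 3 → GroupLieAlgebra (𝓡 3) G) = ![T s, N s, B s] ∧ b.orientation = o
  torsion : ∀ s ∈ J, τ s = ip g (covDeriv α N s) (B s)

/-- `τ_G = (1/2) ⟨[T, N], B⟩`. -/
def tauG [LieGroup (𝓡 3) ∞ G] (g : Metric G) (T N B : ℝ → GroupLieAlgebra (𝓡 3) G) (s : ℝ) : ℝ :=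
  (1 / 2) * ip g ⁅T s, N s⁆ (B s)

/-- The modified torsion `τ - τ_G`. -/
def modTorsion [LieGroup (𝓡 3) ∞ G] (g : Metric G) (T N B : ℝ → GroupLieAlgebra (𝓡 3) G)
    (τ : ℝ → ℝ) (s : ℝ) : ℝ :=
  τ s - tauG g T N B s

/-- The harmonic curvature function `H = (τ - τ_G) / κ`. -/
def harmonicCurvature [LieGroup (𝓡 3) ∞ G] (g : Metric G)
    (T N B : ℝ → GroupLieAlgebra (𝓡 3) G) (κ τ : ℝ → ℝ) (s : ℝ) : ℝ :=
  modTorsion g T N B τ s / κ s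

/-- `ρ = (τ - τ_G)' / κ'`. -/
def rho [LieGroup (𝓡 3) ∞ G] (g : Metric G)
    (T N B : ℝ → GroupLieAlgebra (𝓡 3) G) (κ τ : ℝ → ℝ) (s : ℝ) : ℝ :=
  deriv (modTorsion g T N B τ) s / deriv κ s

/-- `a` is a left development of `α` on `J`: a curve in the Lie algebra whose derivative has the
same coefficients as `α'` has in left-invariant fields. It exists on every open interval and is
unique up to a constant (changing `α` by a left translation does not change it). For the group
`ℝ³` it is `α` itself, up to a translation. -/
def IsDevelopment (J : Set ℝ) (α : ℝ → G) (a : ℝ → GroupLieAlgebra (𝓡 3) G) : Prop :=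
  ∀ s ∈ J, HasDerivAt a (velocity α s) s

/-- The line through `a s` with direction `N s`. -/
def normalLine (a N : ℝ → GroupLieAlgebra (𝓡 3) G) (s : ℝ) : Set (GroupLieAlgebra (𝓡 3) G) :=
  range (fun r : ℝ => a s + r • N s)

/-- `(α, α₁)` is a Bertrand pair, with principal normals `N`, `N₁`, the point `α s` corresponding
to `α₁ (h s)`: `h` is a smooth bijection of the parameter intervals, the principal normal lines at
corresponding points are equal, and the two curves do not coincide. Points and lines are
added as in the Lie algebra, in which the curves are developed: the equality says
`α = α₁ ∘ h + λ N₁ ∘ h`, an equation that is differentiated in left-invariant coefficients. -/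
def IsBertrandPair (J J₁ : Set ℝ) (α α₁ : ℝ → G) (N N₁ : ℝ → GroupLieAlgebra (𝓡 3) G)
    (h : ℝ → ℝ) : Prop :=
  ContDiffOn ℝ ∞ h J ∧ BijOn h J J₁ ∧
    ∃ a a₁ : ℝ → GroupLieAlgebra (𝓡 3) G, IsDevelopment J α a ∧ IsDevelopment J₁ α₁ a₁ ∧
      (∀ s ∈ J, normalLine a N s = normalLine a₁ N₁ (h s)) ∧ ¬ EqOn a (a₁ ∘ h) J

end LieBertrand

end

/-! In left-invariant coefficients the problem becomes Euclidean. Since `⁅T, T⁆ = 0`, `D_T T` is the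
plain derivative `T'`, and the bracket term in `⟨D_T N, B⟩` is exactly `τ_G`. So `(T, N, B)` obeys
the Euclidean Frenet equations for `T'` and `N'` with torsion `m = τ - τ_G`
(`IsFrenetApparatus.frenetFrame`), and the developments form a classical Bertrand pair.

For such a pair, `N = ε N₁`, `a = a₁ + l N₁` with a constant `l ≠ 0`, and `T = c T₁ + d B₁` with
constants `c² + d² = 1` (quantities with index 1 taken at `h s`). Differentiating the offset
equation gives `c = h' (1 - l κ₁)` and `d = h' l m₁`, hence the affine relation `d (1 - l κ₁) = c l
m₁` on `J₁`. Its derivative gives `d = -c ρ` wherever `κ₁' ≠ 0`, and the unit condition then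
determines `c` up to the sign `δ`. Differentiating `N = ε N₁` gives `κ` and `m`; eliminating `l`
yields the stated formulas (`FrenetFrame.bertrand`). -/

namespace LieBertrand

/-! ### Oriented orthonormal frames and their relative rotation. -/

section FrenetFrame

variable {V : Type*} [NormedAddCommGroup V] [NormedSpace ℝ V]

/-- A differentiable moving frame on `J` that is positively oriented, orthonormal for the bilinear
form `β`, and satisfies the first two Frenet equations with curvature `κ` and torsion `m`. -/
structure FrenetFrame (β : V →L[ℝ] V →L[ℝ] ℝ) (o : Orientation ℝ V (Fin 3)) (J : Set ℝ)
    (T N B : ℝ → V) (κ m : ℝ → ℝ) : Prop where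
  deriv_tangent : ∀ s ∈ J, HasDerivAt T (κ s • N s) s
  deriv_normal : ∀ s ∈ J, HasDerivAt N (-κ s • T s + m s • B s) s
  pos : ∀ s ∈ J, 0 < κ s
  tt : ∀ s ∈ J, β (T s) (T s) = 1
  nn : ∀ s ∈ J, β (N s) (N s) = 1
  bb : ∀ s ∈ J, β (B s) (B s) = 1
  tn : ∀ s ∈ J, β (T s) (N s) = 0
  tb : ∀ s ∈ J, β (T s) (B s) = 0
  nb : ∀ s ∈ J, β (N s) (B s) = 0
  oriented : ∀ s ∈ J, ∃ b : Module.Basis (Fin 3) ℝ V,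
    (b : Fin 3 → V) = ![T s, N s, B s] ∧ b.orientation = o

/-- A vector is the sum of its components in an orthonormal basis. -/
lemma eq_sum_of_orthonormal_basis {β : V →L[ℝ] V →L[ℝ] ℝ} (hs : ∀ v w, β v w = β w v)
    (b : Module.Basis (Fin 3) ℝ V) {t n e : V} (hb : (b : Fin 3 → V) = ![t, n, e])
    (tt : β t t = 1) (nn : β n n = 1) (ee : β e e = 1) (tn : β t n = 0) (te : β t e = 0)
    (ne : β n e = 0) (v : V) : v = β v t • t + β v n • n + β v e • e := by
  obtain ⟨x, y, z, rfl⟩ : ∃ x y z : ℝ, v = x • t + y • n + z • e :=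
    ⟨b.repr v 0, b.repr v 1, b.repr v 2, by
      simpa [Fin.sum_univ_three, hb] using (b.sum_repr v).symm⟩
  have nt := (hs n t).trans tn
  have et := (hs e t).trans te
  have en := (hs e n).trans ne
  simp [tt, nn, ee, tn, te, ne, nt, et, en]

variable {β : V →L[ℝ] V →L[ℝ] ℝ} {o : Orientation ℝ V (Fin 3)} {J J₁ : Set ℝ}
  {T N B T₁ N₁ B₁ : ℝ → V} {κ m κ₁ m₁ : ℝ → ℝ} {h : ℝ → ℝ}

lemma FrenetFrame.expand (hF : FrenetFrame β o J T N B κ m) (hs : ∀ v w, β v w = β w v) {s : ℝ}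
    (hsJ : s ∈ J) (v : V) :
    v = β v (T s) • T s + β v (N s) • N s + β v (B s) • B s := by
  obtain ⟨b, hb, -⟩ := hF.oriented s hsJ
  exact eq_sum_of_orthonormal_basis hs b hb (hF.tt s hsJ) (hF.nn s hsJ) (hF.bb s hsJ) (hF.tn s hsJ)
    (hF.tb s hsJ) (hF.nb s hsJ) v

lemma hasDerivAt_bilin {f g : ℝ → V} {f' g' : V} {s : ℝ} (hf : HasDerivAt f f' s)
    (hg : HasDerivAt g g' s) :
    HasDerivAt (fun t => β (f t) (g t)) (β f' (g s) + β (f s) g') s := by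
  have h1 : HasDerivAt (fun t => β (f t)) (β f') s := β.hasFDerivAt.comp_hasDerivAt s hf
  exact h1.clm_apply hg

lemma eq_const_of_hasDerivAt_zero {f : ℝ → ℝ} (hJ : IsOpen J) (hJc : J.OrdConnected)
    (hf : ∀ s ∈ J, HasDerivAt f 0 s) : ∃ c, ∀ s ∈ J, f s = c := by
  refine hJ.exists_is_const_of_fderiv_eq_zero (𝕜 := ℝ) hJc.isPreconnected
    (fun s hs => (hf s hs).differentiableAt.differentiableWithinAt) fun s hs => ?_
  ext
  simpa using (hf s hs).deriv

/-- A continuous function on an interval whose square is constant is constant. -/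
lemma eq_const_of_sq_eq {f : ℝ → ℝ} {c : ℝ} (hJc : J.OrdConnected) (hf : ContinuousOn f J)
    (hsq : ∀ s ∈ J, f s ^ 2 = c ^ 2) : (∀ s ∈ J, f s = c) ∨ ∀ s ∈ J, f s = -c := by
  by_cases hc : c = 0
  · left
    intro s hs
    have := hsq s hs
    rw [hc] at this ⊢
    simpa using this
  · exact hJc.isPreconnected.eq_or_eq_neg_of_sq_eq hf continuousOn_const
      (fun s hs => by simpa using hsq s hs) (fun _ => hc)

lemma det_pos_of_orientation_eq (e : Module.Basis (Fin 3) ℝ V) (b : Module.Basis (Fin 3) ℝ V)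
    {v : Fin 3 → V} (hb : (b : Fin 3 → V) = v) (h : e.orientation = b.orientation) :
    0 < e.det v := by
  rw [← hb]
  exact (e.orientation_eq_iff_det_pos b).1 h

lemma continuousOn_det (e : Module.Basis (Fin 3) ℝ V) {X Y Z : ℝ → V} (hX : ContinuousOn X J)
    (hY : ContinuousOn Y J) (hZ : ContinuousOn Z J) :
    ContinuousOn (fun s => e.det ![X s, Y s, Z s]) J := by
  have : FiniteDimensional ℝ V := Module.Finite.of_basis e
  have hc : ∀ i, Continuous fun v => e.repr v i := fun i =>
    LinearMap.continuous_of_finiteDimensional (e.coord i)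
  simp only [Module.Basis.det_apply, Matrix.det_fin_three, Module.Basis.toMatrix_apply,
    Matrix.cons_val_zero, Matrix.cons_val_one, Matrix.cons_val]
  have hX' := fun i => (hc i).comp_continuousOn hX
  have hY' := fun i => (hc i).comp_continuousOn hY
  have hZ' := fun i => (hc i).comp_continuousOn hZ
  simp only [Function.comp_def] at hX' hY' hZ'
  fun_prop

/-- Lets the sign of the coefficient `d` be read off from a determinant that does not contain `z`'s
own frame vector as an argument. -/
lemma det_update_smul (e : Module.Basis (Fin 3) ℝ V) (x y z : V) (c d : ℝ) :
    e.det ![x, y, c • x + d • z] = d * e.det ![x, y, z] := by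
  simp only [Module.Basis.det_apply, Matrix.det_fin_three, Module.Basis.toMatrix_apply,
    Matrix.cons_val_zero, Matrix.cons_val_one, Matrix.cons_val, map_add, map_smul,
    Finsupp.add_apply, Finsupp.smul_apply, smul_eq_mul]
  ring

/-- Used to fix the sign of the second binormal: both frames are positive, so `ε * σ` must be
positive. -/
lemma det_rotate (e : Module.Basis (Fin 3) ℝ V) (x y z : V) (c d ε σ : ℝ) :
    e.det ![c • x + d • z, ε • y, σ • (c • z - d • x)] =
      ε * σ * (c ^ 2 + d ^ 2) * e.det ![x, y, z] := by
  simp only [Module.Basis.det_apply, Matrix.det_fin_three, Module.Basis.toMatrix_apply,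
    Matrix.cons_val_zero, Matrix.cons_val_one, Matrix.cons_val, map_add, map_sub, map_smul,
    Finsupp.add_apply, Finsupp.sub_apply, Finsupp.smul_apply, smul_eq_mul]
  ring

/-- If the principal normals of two frames are parallel at corresponding points and the tangents
enclose a constant angle, then the angle has a constant sine as well, and the binormals turn by the
same angle. -/
lemma FrenetFrame.rotation (hF : FrenetFrame β o J T N B κ m)
    (hF₁ : FrenetFrame β o J₁ T₁ N₁ B₁ κ₁ m₁) (hs : ∀ v w, β v w = β w v)
    (hJc : J.OrdConnected) (hne : J.Nonempty) (hmaps : MapsTo h J J₁) (hh : ContinuousOn h J)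
    {ε c : ℝ} (hε : ε = 1 ∨ ε = -1) (hN : ∀ s ∈ J, N s = ε • N₁ (h s))
    (hc : ∀ s ∈ J, β (T s) (T₁ (h s)) = c) :
    ∃ d : ℝ, c ^ 2 + d ^ 2 = 1 ∧ ∀ s ∈ J, T s = c • T₁ (h s) + d • B₁ (h s) ∧
      B s = ε • (c • B₁ (h s) - d • T₁ (h s)) := by
  obtain ⟨s₀, hs₀⟩ := hne
  have hε0 : ε ≠ 0 := by rcases hε with rfl | rfl <;> norm_num
  have hεε : ε * ε = 1 := by rcases hε with rfl | rfl <;> norm_num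
  set f : ℝ → ℝ := fun s => β (T s) (B₁ (h s)) with hf
  have hTN : ∀ s ∈ J, β (T s) (N₁ (h s)) = 0 := fun s hsJ => by
    have := hF.tn s hsJ
    rw [hN s hsJ, map_smul, smul_eq_mul] at this
    exact (mul_eq_zero.1 this).resolve_left hε0
  have hT : ∀ s ∈ J, T s = c • T₁ (h s) + f s • B₁ (h s) := fun s hsJ => by
    have := hF₁.expand hs (hmaps hsJ) (T s)
    rwa [hc s hsJ, hTN s hsJ, zero_smul, add_zero] at this
  have hsq : ∀ s ∈ J, c ^ 2 + f s ^ 2 = 1 := fun s hsJ => by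
    have := hF.tt s hsJ
    nth_rewrite 2 [hT s hsJ] at this
    rw [map_add, map_smul, map_smul, hc s hsJ] at this
    simp only [smul_eq_mul] at this
    linarith [show f s * β (T s) (B₁ (h s)) = f s * f s from rfl]
  obtain ⟨e, -, heo⟩ := hF.oriented s₀ hs₀
  have hdet₁ : ∀ s ∈ J, 0 < e.det ![T₁ (h s), N₁ (h s), B₁ (h s)] := fun s hsJ => by
    obtain ⟨b, hb, hbo⟩ := hF₁.oriented _ (hmaps hsJ)
    exact det_pos_of_orientation_eq e b hb (heo.trans hbo.symm)
  have hdet : ∀ s ∈ J, 0 < e.det ![T s, N s, B s] := fun s hsJ => by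
    obtain ⟨b, hb, hbo⟩ := hF.oriented s hsJ
    exact det_pos_of_orientation_eq e b hb (heo.trans hbo.symm)
  -- A frame carries no continuity of the binormal, so `f` cannot be treated as continuous directly.
  -- This determinant involves only `T₁`, `N₁`, `T`, is continuous, and has the sign of `f`.
  have hfd : ∀ s ∈ J, e.det ![T₁ (h s), N₁ (h s), T s]
      = f s * e.det ![T₁ (h s), N₁ (h s), B₁ (h s)] := fun s hsJ => by
    rw [← det_update_smul e _ _ _ c, ← hT s hsJ]
  have hcontF : ContinuousOn (fun s => e.det ![T₁ (h s), N₁ (h s), T s]) J := by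
    refine continuousOn_det e ?_ ?_ ?_
    · exact ContinuousOn.comp (t := J₁)
        (fun s hsJ => (hF₁.deriv_tangent s hsJ).continuousAt.continuousWithinAt) hh hmaps
    · exact ContinuousOn.comp (t := J₁)
        (fun s hsJ => (hF₁.deriv_normal s hsJ).continuousAt.continuousWithinAt) hh hmaps
    · exact fun s hsJ => (hF.deriv_tangent s hsJ).continuousAt.continuousWithinAt
  have hsame : ∀ s ∈ J, f s ^ 2 = f s₀ ^ 2 := fun s hsJ => by
    linarith [hsq s hsJ, hsq s₀ hs₀]
  have hconst : ∀ s ∈ J, f s = f s₀ := by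
    intro s hsJ
    rcases sq_eq_sq_iff_eq_or_eq_neg.1 (hsame s hsJ) with h1 | h1
    · exact h1
    by_contra hne
    have h0 : f s₀ ≠ 0 := fun h0 => hne (by rw [h1, h0, neg_zero])
    have hne0 : ∀ t ∈ J, e.det ![T₁ (h t), N₁ (h t), T t] ≠ 0 := fun t ht => by
      rw [hfd t ht]
      refine mul_ne_zero (fun h2 => h0 ?_) (hdet₁ t ht).ne'
      have := hsame t ht
      rw [h2] at this
      simpa using this.symm
    -- If `f` took both values `±f s₀ ≠ 0`, the determinant would change sign and vanish somewhere
    -- on the interval, although `f²` is a nonzero constant.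
    have hord := (hJc.isPreconnected.image _ hcontF).ordConnected
    have hneg : e.det ![T₁ (h s), N₁ (h s), T s] * e.det ![T₁ (h s₀), N₁ (h s₀), T s₀] < 0 := by
      rw [hfd s hsJ, hfd s₀ hs₀, h1]
      have h2 := mul_pos (mul_pos (hdet₁ s hsJ) (hdet₁ s₀ hs₀)) (sq_pos_of_ne_zero h0)
      linarith [h2]
    have hmem : (0 : ℝ) ∈ (fun s => e.det ![T₁ (h s), N₁ (h s), T s]) '' J := by
      rcases mul_neg_iff.1 hneg with ⟨ha, hb⟩ | ⟨ha, hb⟩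
      · exact hord.out (mem_image_of_mem _ hs₀) (mem_image_of_mem _ hsJ) ⟨hb.le, ha.le⟩
      · exact hord.out (mem_image_of_mem _ hsJ) (mem_image_of_mem _ hs₀) ⟨ha.le, hb.le⟩
    obtain ⟨t, ht, ht0⟩ := hmem
    exact hne0 t ht ht0
  refine ⟨f s₀, hsq s₀ hs₀, fun s hsJ => ?_⟩
  have hT' := hT s hsJ
  rw [hconst s hsJ] at hT'
  refine ⟨hT', ?_⟩
  set d := f s₀ with hd
  have hcd : c ^ 2 + d ^ 2 = 1 := hsq s₀ hs₀
  have hBN : β (B s) (N₁ (h s)) = 0 := by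
    have := hF.nb s hsJ
    rw [hs, hN s hsJ, map_smul, smul_eq_mul] at this
    exact (mul_eq_zero.1 this).resolve_left hε0
  have hB := hF₁.expand hs (hmaps hsJ) (B s)
  rw [hBN, zero_smul, add_zero] at hB
  set p := β (B s) (T₁ (h s)) with hp
  set q := β (B s) (B₁ (h s)) with hq
  have horth : c * p + d * q = 0 := by
    have := hF.tb s hsJ
    rw [hs, hT', map_add, map_smul, map_smul] at this
    exact this
  have hunit : p ^ 2 + q ^ 2 = 1 := by
    have := hF.bb s hsJ
    nth_rewrite 2 [hB] at this
    rw [map_add, map_smul, map_smul] at this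
    simp only [smul_eq_mul, ← hp, ← hq] at this
    linarith
  -- `σ` is the determinant of `(T, B)` in the basis `(T₁, B₁)`. Orthogonality gives `(p, q) = σ
  -- (-d, c)`, unit length gives `σ = ±1`, and the orientation selects `σ = ε`.
  set σ := c * q - d * p with hσ
  have hpσ : p = -(σ * d) := by
    rw [hσ]; linear_combination (-p) * hcd + c * horth
  have hqσ : q = σ * c := by
    rw [hσ]; linear_combination (-q) * hcd + d * horth
  have hB' : B s = σ • (c • B₁ (h s) - d • T₁ (h s)) := by
    rw [hB, hpσ, hqσ]; module
  have hpos := hdet s hsJ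
  rw [hB', hT', hN s hsJ, det_rotate, hcd, mul_one] at hpos
  have hεσ : 0 < ε * σ := pos_of_mul_pos_left hpos (hdet₁ s hsJ).le
  have hσ2 : σ ^ 2 = 1 := by
    rw [hpσ, hqσ] at hunit
    linear_combination hunit - σ ^ 2 * hcd
  have : σ = ε := by
    rcases hε with rfl | rfl <;> rcases mul_self_eq_one_iff.1 ((sq σ).symm.trans hσ2) with h1 | h1 <;>
      first | exact h1 | (rw [h1] at hεσ; norm_num at hεσ)
  rw [← this]; exact hB'

end FrenetFrame

/-! ### Bertrand pairs of framed curves. -/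

section BertrandFrames

variable {V : Type*} [NormedAddCommGroup V] [NormedSpace ℝ V]
  {β : V →L[ℝ] V →L[ℝ] ℝ} {o : Orientation ℝ V (Fin 3)} {J J₁ : Set ℝ}
  {T N B T₁ N₁ B₁ a a₁ : ℝ → V} {κ m κ₁ m₁ : ℝ → ℝ} {h : ℝ → ℝ}

/-- Equal lines have proportional directions. -/
lemma exists_smul_of_range_eq {p q n n₁ : V}
    (hl : range (fun r : ℝ => p + r • n) = range (fun r : ℝ => q + r • n₁)) :
    (∃ r : ℝ, n = r • n₁) ∧ ∃ l : ℝ, p = q + l • n₁ := by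
  obtain ⟨l, hl0⟩ : p ∈ range (fun r : ℝ => q + r • n₁) := hl ▸ ⟨0, by simp⟩
  obtain ⟨k, hk⟩ : p + n ∈ range (fun r : ℝ => q + r • n₁) := hl ▸ ⟨1, by simp⟩
  refine ⟨⟨k - l, ?_⟩, l, hl0.symm⟩
  simp only at hl0 hk
  rw [sub_smul, ← add_sub_add_left_eq_sub _ _ q, hk, hl0, add_sub_cancel_left]

/-- The principal normals agree up to a constant sign. -/
lemma FrenetFrame.exists_sign (hF : FrenetFrame β o J T N B κ m)
    (hF₁ : FrenetFrame β o J₁ T₁ N₁ B₁ κ₁ m₁)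
    (hJc : J.OrdConnected) (hmaps : MapsTo h J J₁) (hh : ContinuousOn h J)
    (hpar : ∀ s ∈ J, ∃ r : ℝ, N s = r • N₁ (h s)) :
    ∃ ε : ℝ, (ε = 1 ∨ ε = -1) ∧ ∀ s ∈ J, N s = ε • N₁ (h s) := by
  have hr : ∀ s ∈ J, N s = β (N s) (N₁ (h s)) • N₁ (h s) := fun s hs => by
    obtain ⟨r, hr⟩ := hpar s hs
    have : β (N s) (N₁ (h s)) = r := by simp [hr, hF₁.nn _ (hmaps hs)]
    rw [this, ← hr]
  have hsq : ∀ s ∈ J, β (N s) (N₁ (h s)) ^ 2 = 1 ^ 2 := fun s hs => by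
    have := hF.nn s hs
    nth_rewrite 2 [hr s hs] at this
    rw [map_smul, smul_eq_mul] at this
    rw [sq, this, one_pow]
  have hN : ContinuousOn N J := fun s hs => (hF.deriv_normal s hs).continuousAt.continuousWithinAt
  have hN₁ : ContinuousOn (fun s => N₁ (h s)) J := ContinuousOn.comp (t := J₁)
    (fun s hs => (hF₁.deriv_normal s hs).continuousAt.continuousWithinAt) hh hmaps
  have hcont : ContinuousOn (fun s => β (N s) (N₁ (h s))) J :=
    (β.continuous.comp_continuousOn hN).clm_apply hN₁
  rcases eq_const_of_sq_eq hJc hcont hsq with h1 | h1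
  · exact ⟨1, Or.inl rfl, fun s hs => by rw [← h1 s hs]; exact hr s hs⟩
  · exact ⟨-1, Or.inr rfl, fun s hs => by rw [← h1 s hs]; exact hr s hs⟩

/-- The distance of corresponding points of a Bertrand pair is constant. -/
lemma FrenetFrame.exists_offset (hF : FrenetFrame β o J T N B κ m)
    (hF₁ : FrenetFrame β o J₁ T₁ N₁ B₁ κ₁ m₁) (hs : ∀ v w, β v w = β w v) (hJ : IsOpen J)
    (hJc : J.OrdConnected) (hmaps : MapsTo h J J₁) (hh : ∀ s ∈ J, HasDerivAt h (deriv h s) s)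
    {ε : ℝ} (hε : ε = 1 ∨ ε = -1) (hN : ∀ s ∈ J, N s = ε • N₁ (h s))
    (ha : ∀ s ∈ J, HasDerivAt a (T s) s) (ha₁ : ∀ s ∈ J₁, HasDerivAt a₁ (T₁ s) s)
    (hpt : ∀ s ∈ J, ∃ l : ℝ, a s = a₁ (h s) + l • N₁ (h s)) :
    ∃ l : ℝ, ∀ s ∈ J, a s = a₁ (h s) + l • N₁ (h s) := by
  have hε0 : ε ≠ 0 := by rcases hε with rfl | rfl <;> norm_num
  -- The pointwise offset has no regularity by itself; as an inner product with `N₁` it is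
  -- differentiable. Its derivative vanishes because `T`, `T₁` and `N₁'` are all orthogonal to `N₁`.
  have hl : ∀ s ∈ J, a s - a₁ (h s) = β (a s - a₁ (h s)) (N₁ (h s)) • N₁ (h s) := fun s hsJ => by
    obtain ⟨l, hl⟩ := hpt s hsJ
    simp [hl, hF₁.nn _ (hmaps hsJ)]
  have hder : ∀ s ∈ J, HasDerivAt (fun s => β (a s - a₁ (h s)) (N₁ (h s))) 0 s := fun s hsJ => by
    have h1 := (ha s hsJ).sub ((ha₁ _ (hmaps hsJ)).scomp s (hh s hsJ))
    have h2 := (hF₁.deriv_normal _ (hmaps hsJ)).scomp s (hh s hsJ)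
    have h3 := hasDerivAt_bilin (β := β) h1 h2
    refine HasDerivAt.congr_deriv h3 ?_
    have e1 : β (T s) (N₁ (h s)) = 0 := by
      have := hF.tn s hsJ
      rw [hN s hsJ, map_smul, smul_eq_mul] at this
      exact (mul_eq_zero.1 this).resolve_left hε0
    have e2 := hF₁.tn _ (hmaps hsJ)
    have e3 := hF₁.nb _ (hmaps hsJ)
    have e4 := (hs _ _).trans e2
    have e5 : ∀ w, β (a s - a₁ (h s)) w = β (a s - a₁ (h s)) (N₁ (h s)) * β (N₁ (h s)) w :=
      fun w => by
        conv_lhs => rw [hl s hsJ]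
        simp
    simp only [Function.comp_apply, Pi.sub_apply]
    rw [e5 (_ • _)]
    simp [e1, e2, e3, e4]
  obtain ⟨l, hl'⟩ := eq_const_of_hasDerivAt_zero hJ hJc hder
  refine ⟨l, fun s hsJ => ?_⟩
  rw [← hl' s hsJ, ← hl s hsJ, add_sub_cancel]

/-- The tangents of a Bertrand pair enclose a constant angle. -/
lemma FrenetFrame.exists_angle (hF : FrenetFrame β o J T N B κ m)
    (hF₁ : FrenetFrame β o J₁ T₁ N₁ B₁ κ₁ m₁) (hs : ∀ v w, β v w = β w v) (hJ : IsOpen J)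
    (hJc : J.OrdConnected) (hmaps : MapsTo h J J₁) (hh : ∀ s ∈ J, HasDerivAt h (deriv h s) s)
    {ε : ℝ} (hε : ε = 1 ∨ ε = -1) (hN : ∀ s ∈ J, N s = ε • N₁ (h s)) :
    ∃ c : ℝ, ∀ s ∈ J, β (T s) (T₁ (h s)) = c := by
  have hε0 : ε ≠ 0 := by rcases hε with rfl | rfl <;> norm_num
  refine eq_const_of_hasDerivAt_zero hJ hJc fun s hsJ => ?_
  have h3 := hasDerivAt_bilin (β := β) (hF.deriv_tangent s hsJ)
    ((hF₁.deriv_tangent _ (hmaps hsJ)).scomp s (hh s hsJ))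
  refine HasDerivAt.congr_deriv h3 ?_
  have e1 : β (T s) (N₁ (h s)) = 0 := by
    have := hF.tn s hsJ
    rw [hN s hsJ, map_smul, smul_eq_mul] at this
    exact (mul_eq_zero.1 this).resolve_left hε0
  have e2 : β (N₁ (h s)) (T₁ (h s)) = 0 := (hs _ _).trans (hF₁.tn _ (hmaps hsJ))
  simp [hN s hsJ, e1, e2]

/-- Comparison of the derivatives of two functions on `J₁` that satisfy an affine relation. -/
lemma deriv_affine_relation (hJ₁ : IsOpen J₁) {c d l : ℝ} (hcd : c ^ 2 + d ^ 2 = 1) (hl : l ≠ 0)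
    (hrel : ∀ t ∈ J₁, d * (1 - l * κ₁ t) = c * (l * m₁ t)) {t : ℝ} (ht : t ∈ J₁)
    (hκ : deriv κ₁ t ≠ 0) : c ≠ 0 ∧ d = -c * (deriv m₁ t / deriv κ₁ t) := by
  -- `deriv` is zero where a function is not differentiable, so `hκ` already contains
  -- differentiability.
  have hκd : HasDerivAt κ₁ (deriv κ₁ t) t :=
    (differentiableAt_of_deriv_ne_zero hκ).hasDerivAt
  have hL : HasDerivAt (fun t => d * (1 - l * κ₁ t)) (d * (0 - l * deriv κ₁ t)) t :=
    (((hasDerivAt_const t (1 : ℝ)).sub (hκd.const_mul l))).const_mul d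
  have hev : ∀ᶠ u in nhds t, d * (1 - l * κ₁ u) = c * (l * m₁ u) :=
    Filter.eventually_of_mem (hJ₁.mem_nhds ht) hrel
  -- With `c = 0` the relation would make `κ₁` constant near `t`.
  have hc : c ≠ 0 := by
    rintro rfl
    have hd : d ≠ 0 := by rintro rfl; norm_num at hcd
    have h0 : HasDerivAt (fun t => d * (1 - l * κ₁ t)) 0 t :=
      (hasDerivAt_const t (0 : ℝ)).congr_of_eventuallyEq (hev.mono fun u hu => by simpa using hu)
    have := hL.unique h0
    simp [hd, hl, hκ] at this
  refine ⟨hc, ?_⟩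
  -- Differentiability of `m₁` is not given; it follows by solving the relation for `m₁` near `t`.
  have hm : HasDerivAt m₁ ((c * l)⁻¹ * (d * (0 - l * deriv κ₁ t))) t :=
    (hL.const_mul (c * l)⁻¹).congr_of_eventuallyEq (hev.mono fun u hu => by
      simp only
      rw [hu]; field_simp)
  rw [hm.deriv]
  field_simp
  ring

/-- The formulas for a Bertrand pair of framed curves in an oriented Euclidean space. -/
theorem FrenetFrame.bertrand (hF : FrenetFrame β o J T N B κ m)
    (hF₁ : FrenetFrame β o J₁ T₁ N₁ B₁ κ₁ m₁) (hs : ∀ v w, β v w = β w v) (hJ : IsOpen J)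
    (hJc : J.OrdConnected) (hJ₁ : IsOpen J₁)
    (hmaps : MapsTo h J J₁) (hsurj : SurjOn h J J₁) (hh : ∀ s ∈ J, HasDerivAt h (deriv h s) s)
    (ha : ∀ s ∈ J, HasDerivAt a (T s) s) (ha₁ : ∀ s ∈ J₁, HasDerivAt a₁ (T₁ s) s)
    (hline : ∀ s ∈ J, range (fun r : ℝ => a s + r • N s)
      = range (fun r : ℝ => a₁ (h s) + r • N₁ (h s)))
    (hne : ¬ EqOn a (a₁ ∘ h) J) :
    ∃ ε δ : ℝ, (ε = 1 ∨ ε = -1) ∧ (δ = 1 ∨ δ = -1) ∧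
      (∀ s ∈ J, N s = ε • N₁ (h s)) ∧
      ∀ s ∈ J, deriv κ₁ (h s) ≠ 0 → ∀ ρ H₁ : ℝ, ρ = deriv m₁ (h s) / deriv κ₁ (h s) →
        H₁ = m₁ (h s) / κ₁ (h s) →
        T s = (-δ / Real.sqrt (1 + ρ ^ 2)) • (T₁ (h s) - ρ • B₁ (h s)) ∧
        B s = (-(δ * ε) / Real.sqrt (1 + ρ ^ 2)) • (ρ • T₁ (h s) + B₁ (h s)) ∧
        (δ = 1 ↔ β (T s) (T₁ (h s)) < 0) ∧
        (H₁ ≠ 0 →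
          deriv h s = δ * ((ρ - H₁) / (H₁ * Real.sqrt (1 + ρ ^ 2))) ∧
          κ s = -ε * κ₁ (h s) * (1 + H₁ * ρ) * (ρ - H₁) / (H₁ * (1 + ρ ^ 2)) ∧
          m s = κ₁ (h s) * (ρ - H₁) ^ 2 / (H₁ * (1 + ρ ^ 2))) := by
  have hhc : ContinuousOn h J := fun s hs => (hh s hs).continuousAt.continuousWithinAt
  have hJne : J.Nonempty := by
    rw [nonempty_iff_ne_empty]; rintro rfl; exact hne (eqOn_empty _ _)
  obtain ⟨ε, hε, hN⟩ := hF.exists_sign hF₁ hJc hmaps hhc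
    fun s hsJ => (exists_smul_of_range_eq (hline s hsJ)).1
  obtain ⟨l, hl⟩ := hF.exists_offset hF₁ hs hJ hJc hmaps hh hε hN ha ha₁
    fun s hsJ => (exists_smul_of_range_eq (hline s hsJ)).2
  obtain ⟨c, hc⟩ := hF.exists_angle hF₁ hs hJ hJc hmaps hh hε hN
  obtain ⟨d, hcd, hrot⟩ := hF.rotation hF₁ hs hJc hJne hmaps hhc hε hN hc
  have hl0 : l ≠ 0 := by
    rintro rfl
    exact hne fun s hsJ => by simp [hl s hsJ]
  have hεε : ε * ε = 1 := by rcases hε with rfl | rfl <;> norm_num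
  have hdT : ∀ s ∈ J, T s = deriv h s • T₁ (h s)
      + l • (deriv h s • (-κ₁ (h s) • T₁ (h s) + m₁ (h s) • B₁ (h s))) := fun s hsJ => by
    have h1 := ((ha₁ _ (hmaps hsJ)).scomp s (hh s hsJ)).add
      (((hF₁.deriv_normal _ (hmaps hsJ)).scomp s (hh s hsJ)).const_smul l)
    refine (ha s hsJ).unique (h1.congr_of_eventuallyEq ?_)
    exact Filter.eventually_of_mem (hJ.mem_nhds hsJ) fun u hu => hl u hu
  have hc' : ∀ s ∈ J, c = deriv h s * (1 - l * κ₁ (h s)) := fun s hsJ => by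
    rw [← hc s hsJ, hdT s hsJ]
    simp only [map_add, map_smul, add_apply, smul_apply,
      hF₁.tt _ (hmaps hsJ), hs (B₁ _) (T₁ _), hF₁.tb _ (hmaps hsJ), smul_eq_mul]
    ring
  have hd' : ∀ s ∈ J, d = deriv h s * (l * m₁ (h s)) := fun s hsJ => by
    have h1 : β (T s) (B₁ (h s)) = d := by
      rw [(hrot s hsJ).1]
      simp [hF₁.tb _ (hmaps hsJ), hF₁.bb _ (hmaps hsJ)]
    rw [← h1, hdT s hsJ]
    simp only [map_add, map_smul, add_apply, smul_apply,
      hF₁.bb _ (hmaps hsJ), hF₁.tb _ (hmaps hsJ), smul_eq_mul]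
    ring
  -- A smooth bijection may have critical points; here one would force `c = d = 0`.
  have hh0 : ∀ s ∈ J, deriv h s ≠ 0 := fun s hsJ h0 => by
    have h1 := hc' s hsJ
    have h2 := hd' s hsJ
    rw [h0, zero_mul] at h1 h2
    rw [h1, h2] at hcd
    norm_num at hcd
  have hrel : ∀ t ∈ J₁, d * (1 - l * κ₁ t) = c * (l * m₁ t) := fun t ht => by
    obtain ⟨s, hsJ, rfl⟩ := hsurj ht
    refine mul_left_cancel₀ (hh0 s hsJ) ?_
    linear_combination c * hd' s hsJ - d * hc' s hsJ
  -- the derivative of `N = ε N₁ ∘ h`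
  have hdN : ∀ s ∈ J, -κ s • T s + m s • B s
      = ε • (deriv h s • (-κ₁ (h s) • T₁ (h s) + m₁ (h s) • B₁ (h s))) := fun s hsJ => by
    have h1 := ((hF₁.deriv_normal _ (hmaps hsJ)).scomp s (hh s hsJ)).const_smul ε
    refine (hF.deriv_normal s hsJ).unique (h1.congr_of_eventuallyEq ?_)
    exact Filter.eventually_of_mem (hJ.mem_nhds hsJ) fun u hu => hN u hu
  have hκ' : ∀ s ∈ J, κ s = ε * deriv h s * (c * κ₁ (h s) - d * m₁ (h s)) := fun s hsJ => by
    have h1 := congrArg (fun v => β v (T s)) (hdN s hsJ)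
    have h2 := (hrot s hsJ).1
    have h3 : β (T₁ (h s)) (T s) = c := by rw [hs, hc s hsJ]
    have h4 : β (B₁ (h s)) (T s) = d := by
      rw [h2]
      simp [hs (B₁ _) (T₁ _), hF₁.tb _ (hmaps hsJ), hF₁.bb _ (hmaps hsJ)]
    simp only [map_add, map_smul, add_apply, smul_apply,
      hF.tt s hsJ, hs (B s) (T s), hF.tb s hsJ, h3, h4, smul_eq_mul] at h1
    linear_combination -h1
  have hm' : ∀ s ∈ J, m s = deriv h s * (d * κ₁ (h s) + c * m₁ (h s)) := fun s hsJ => by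
    have h1 := congrArg (fun v => β v (B s)) (hdN s hsJ)
    have h2 := (hrot s hsJ).2
    have h3 : β (T₁ (h s)) (B s) = -(ε * d) := by
      rw [h2]
      simp [hF₁.tb _ (hmaps hsJ), hF₁.tt _ (hmaps hsJ)]
    have h4 : β (B₁ (h s)) (B s) = ε * c := by
      rw [h2]
      simp [hs (B₁ _) (T₁ _), hF₁.tb _ (hmaps hsJ), hF₁.bb _ (hmaps hsJ)]
    simp only [map_add, map_smul, add_apply, smul_apply,
      hF.bb s hsJ, hF.tb s hsJ, h3, h4, smul_eq_mul] at h1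
    linear_combination h1 + deriv h s * (d * κ₁ (h s) + c * m₁ (h s)) * hεε
  -- `δ` is minus the sign of `c`, chosen before `s`. The value at `c = 0` is immaterial, since `κ₁'
  -- ≠ 0` excludes that case.
  refine ⟨ε, if c < 0 then 1 else -1, hε, by split_ifs <;> simp, hN, fun s hsJ hκ ρ H₁ hρ hH => ?_⟩
  obtain ⟨hc0, hdρ⟩ := deriv_affine_relation hJ₁ hcd hl0 hrel (hmaps hsJ) hκ
  rw [← hρ] at hdρ
  generalize hδ : (if c < 0 then 1 else -1 : ℝ) = δ
  have hδc : δ = 1 ↔ c < 0 := by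
    rw [← hδ]; split_ifs with h1 <;> simp [h1]; norm_num
  set w := Real.sqrt (1 + ρ ^ 2) with hw
  have hw2 : w ^ 2 = 1 + ρ ^ 2 := Real.sq_sqrt (by positivity)
  have hwpos : 0 < w := Real.sqrt_pos.2 (by positivity)
  have hcw : c = -δ / w := by
    have h1 : (c * w) ^ 2 = 1 := by
      rw [mul_pow, hw2]; rw [hdρ] at hcd; linear_combination hcd
    rw [eq_div_iff hwpos.ne']
    rw [← hδ]
    split_ifs with h2
    · have := mul_neg_of_neg_of_pos h2 hwpos
      nlinarith
    · have := mul_nonneg (not_lt.1 h2) hwpos.le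
      nlinarith
  have hδδ : δ * δ = 1 := by rw [← hδ]; split_ifs <;> norm_num
  refine ⟨?_, ?_, ?_, fun hH0 => ?_⟩
  · rw [(hrot s hsJ).1, hdρ, ← hcw]; module
  · rw [(hrot s hsJ).2, hdρ, show -(δ * ε) / w = ε * (-δ / w) by ring, ← hcw]; module
  · rw [hc s hsJ, hδc]
  have hκ0 : κ₁ (h s) ≠ 0 := (hF₁.pos _ (hmaps hsJ)).ne'
  have hm : m₁ (h s) = H₁ * κ₁ (h s) := by rw [hH]; field_simp
  -- This determines `l` in terms of `ρ` and `H₁`; kept as a product, it needs no division by `ρ -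
  -- H₁`, which is not yet known to be nonzero.
  have hlρ : l * κ₁ (h s) * (ρ - H₁) = ρ := by
    have h1 := hrel _ (hmaps hsJ)
    rw [hdρ, hm] at h1
    refine mul_left_cancel₀ hc0 ?_
    linear_combination h1
  have hhc : deriv h s * H₁ = -c * (ρ - H₁) := by
    have h1 := hd' s hsJ
    rw [hdρ, hm] at h1
    refine mul_left_cancel₀ (mul_ne_zero hl0 hκ0) ?_
    linear_combination -h1 + c * hlρ
  have hhv : deriv h s = δ * ((ρ - H₁) / (H₁ * w)) := by
    rw [hcw] at hhc
    field_simp at hhc ⊢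
    linear_combination hhc
  -- Only the product `h' c` enters `κ` and `m`; in it `δ² = 1`, so these formulas are free of `δ`.
  have hhcc : deriv h s * c = -(ρ - H₁) / (H₁ * w ^ 2) := by
    rw [hhv, hcw]
    field_simp
    linear_combination (-(ρ - H₁)) * hδδ
  refine ⟨hhv, ?_, ?_⟩
  · have h1 : κ s = ε * (deriv h s * c) * κ₁ (h s) * (1 + H₁ * ρ) := by
      rw [hκ' s hsJ, hm, hdρ]; ring
    rw [h1, hhcc, hw2]; ring
  · have h1 : m s = (deriv h s * c) * κ₁ (h s) * (H₁ - ρ) := by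
      rw [hm' s hsJ, hm, hdρ]; ring
    rw [h1, hhcc, hw2]; ring

end BertrandFrames

/-! ### Frenet frame of a unit tangent field. -/

/-- A unit field `T` with `T' = κ N` and nowhere vanishing `κ` has a Frenet frame. -/
lemma FrenetFrame.of_unit_tangent {V : Type*} [NormedAddCommGroup V] [NormedSpace ℝ V]
    {β : V →L[ℝ] V →L[ℝ] ℝ} {o : Orientation ℝ V (Fin 3)} {J : Set ℝ} {T N B : ℝ → V}
    {κ m : ℝ → ℝ} (hβ : ∀ v w, β v w = β w v) (hJ : IsOpen J) (hT : ContDiffOn ℝ ∞ T J)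
    (hTT : ∀ s ∈ J, β (T s) (T s) = 1)
    (hκ : ∀ s ∈ J, κ s = Real.sqrt (β (deriv T s) (deriv T s))) (hpos : ∀ s ∈ J, 0 < κ s)
    (hN : ∀ s ∈ J, deriv T s = κ s • N s) (hBB : ∀ s ∈ J, β (B s) (B s) = 1)
    (hTB : ∀ s ∈ J, β (T s) (B s) = 0) (hNB : ∀ s ∈ J, β (N s) (B s) = 0)
    (hor : ∀ s ∈ J, ∃ b : Module.Basis (Fin 3) ℝ V,
      (b : Fin 3 → V) = ![T s, N s, B s] ∧ b.orientation = o)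
    (hm : ∀ s ∈ J, m s = β (deriv N s) (B s)) : FrenetFrame β o J T N B κ m := by
  have hTd : ∀ s ∈ J, HasDerivAt T (κ s • N s) s := fun s hs => by
    rw [← hN s hs]
    exact ((hT.contDiffAt (hJ.mem_nhds hs)).differentiableAt (by simp)).hasDerivAt
  have hsq : ∀ s ∈ J, β (deriv T s) (deriv T s) = κ s ^ 2 := fun s hs => by
    have h0 : 0 < β (deriv T s) (deriv T s) := Real.sqrt_pos.1 (hκ s hs ▸ hpos s hs)
    rw [hκ s hs, Real.sq_sqrt h0.le]
  have hNN : ∀ s ∈ J, β (N s) (N s) = 1 := fun s hs => by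
    have h1 := hsq s hs
    rw [hN s hs] at h1
    simp only [map_smul, smul_apply, smul_eq_mul] at h1
    have h2 := (pow_pos (hpos s hs) 2).ne'
    refine mul_left_cancel₀ h2 ?_
    linear_combination h1
  have hzero : ∀ {f : ℝ → ℝ} {f' c s : ℝ}, s ∈ J → HasDerivAt f f' s → (∀ t ∈ J, f t = c) →
      f' = 0 := fun {f f' c s} hs hf hc =>
    hf.unique ((hasDerivAt_const s c).congr_of_eventuallyEq
      (Filter.eventually_of_mem (hJ.mem_nhds hs) hc))
  have hTN : ∀ s ∈ J, β (T s) (N s) = 0 := fun s hs => by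
    have h1 := hzero hs (hasDerivAt_bilin (β := β) (hTd s hs) (hTd s hs)) hTT
    simp only [map_smul, smul_apply, smul_eq_mul, hβ (N s) (T s)] at h1
    have := (hpos s hs).ne'
    refine mul_left_cancel₀ this ?_
    linarith
  -- Near `s` one has `N = κ⁻¹ T'`, and `κ` is the square root of a differentiable positive
  -- function.
  have hNd : ∀ s ∈ J, HasDerivAt N (deriv N s) s := fun s hs => by
    have h1 : DifferentiableAt ℝ (deriv T) s :=
      ((hT.deriv_of_isOpen (m := 1) hJ (by norm_cast)).contDiffAt
        (hJ.mem_nhds hs)).differentiableAt (by simp)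
    have h2 := hasDerivAt_bilin (β := β) h1.hasDerivAt h1.hasDerivAt
    have h3 : β (deriv T s) (deriv T s) ≠ 0 := by
      rw [hsq s hs]; exact (pow_pos (hpos s hs) 2).ne'
    have h4 : DifferentiableAt ℝ κ s := (h2.sqrt h3).differentiableAt.congr_of_eventuallyEq
      (Filter.eventually_of_mem (hJ.mem_nhds hs) hκ)
    have h5 : DifferentiableAt ℝ (fun t => (κ t)⁻¹ • deriv T t) s :=
      (h4.inv (hpos s hs).ne').smul h1
    refine (h5.congr_of_eventuallyEq ?_).hasDerivAt
    refine Filter.eventually_of_mem (hJ.mem_nhds hs) fun t ht => ?_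
    simp only [hN t ht, inv_smul_smul₀ (hpos t ht).ne']
  refine ⟨hTd, fun s hs => ?_, hpos, hTT, hNN, hBB, hTN, hTB, hNB, hor⟩
  obtain ⟨b, hb, -⟩ := hor s hs
  have h1 := eq_sum_of_orthonormal_basis hβ b hb (hTT s hs) (hNN s hs) (hBB s hs) (hTN s hs)
    (hTB s hs) (hNB s hs) (deriv N s)
  have h2 : β (deriv N s) (N s) = 0 := by
    have := hzero hs (hasDerivAt_bilin (β := β) (hNd s hs) (hNd s hs)) hNN
    rw [hβ (N s)] at this
    linarith
  have h3 : β (deriv N s) (T s) = -κ s := by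
    have := hzero hs (hasDerivAt_bilin (β := β) (hTd s hs) (hNd s hs)) hTN
    simp only [map_smul, smul_apply, smul_eq_mul, hNN s hs] at this
    rw [hβ (T s)] at this
    linarith
  rw [h2, h3, ← hm s hs, zero_smul, add_zero] at h1
  rw [← h1]
  exact hNd s hs

/-! ### Left-translated velocities and the passage from the Lie group. -/

/-- A family of linear maps into one fixed tangent space is its own coordinate representation. -/
lemma inTangentCoordinates_apply_of_const {M : Type*} [TopologicalSpace M]
    [ChartedSpace (EuclideanSpace ℝ (Fin 3)) M] [IsManifold (𝓡 3) 1 M] {e : ℝ → M} {p : M}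
    (he : ∀ x, e x = p) (φ : ℝ → ℝ →L[ℝ] EuclideanSpace ℝ (Fin 3)) (x₀ x v : ℝ) :
    inTangentCoordinates 𝓘(ℝ, ℝ) (𝓡 3) id e φ x₀ x v = φ x v := by
  obtain rfl : e = fun _ => p := funext he
  rw [inTangentCoordinates_eq (𝕜 := ℝ) (I := 𝓘(ℝ, ℝ)) (I' := 𝓡 3) (f := id) (g := fun _ => p) φ
    (by simp only [id, chartAt_self_eq]; trivial) (mem_chart_source _ _)]
  simp only [id, ContinuousLinearMap.comp_apply]
  rw [tangentBundleCore_coordChange_model_space]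
  exact (tangentBundleCore (𝓡 3) M).coordChange_self _ _ (mem_chart_source _ _) _

variable {G : Type*} [TopologicalSpace G] [ChartedSpace (EuclideanSpace ℝ (Fin 3)) G] [Group G]

/-- The left-translated velocity of an arc-length curve is a unit vector. -/
lemma ip_velocity_self [LieGroup (𝓡 3) ∞ G] {g : Metric G} (hg : IsBiInvariant g) {J : Set ℝ}
    (hJ : IsOpen J) {α : ℝ → G} (hα : IsUnitSpeedOn g J α) {s : ℝ} (hs : s ∈ J) :
    ip g (velocity α s) (velocity α s) = 1 := by
  have hd : MDifferentiableAt 𝓘(ℝ, ℝ) (𝓡 3) α s :=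
    (hα.smooth.contMDiffAt (hJ.mem_nhds hs)).mdifferentiableAt (by simp)
  have hm : MDifferentiableAt (𝓡 3) (𝓡 3) (fun y => (α s)⁻¹ * y) (α s) :=
    (contMDiff_mul_left (n := ∞)).contMDiffAt.mdifferentiableAt (by simp)
  have h1 := hg.left (α s)⁻¹ (α s) (mfderiv 𝓘(ℝ, ℝ) (𝓡 3) α s (1 : ℝ))
    (mfderiv 𝓘(ℝ, ℝ) (𝓡 3) α s (1 : ℝ))
  rw [hα.unit s hs] at h1
  have h2 : mfderiv 𝓘(ℝ, ℝ) (𝓡 3) (fun t => (α s)⁻¹ * α t) s (1 : ℝ) =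
      mfderiv (𝓡 3) (𝓡 3) (fun y => (α s)⁻¹ * y) (α s) (mfderiv 𝓘(ℝ, ℝ) (𝓡 3) α s (1 : ℝ)) := by
    have := mfderiv_comp s hm hd
    exact congrArg (fun L => L (1 : ℝ)) this
  -- The base point `(α s)⁻¹ * α s` equals `1` only propositionally, so the inner product is
  -- transported along this equality.
  have h3 : ∀ (p : G), p = 1 → ∀ w : EuclideanSpace ℝ (Fin 3),
      g.inner (1 : G) (w : TangentSpace (𝓡 3) (1 : G)) (w : TangentSpace (𝓡 3) (1 : G)) =
        g.inner p (w : TangentSpace (𝓡 3) p) (w : TangentSpace (𝓡 3) p) := by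
    rintro p rfl w; rfl
  exact (h3 _ (inv_mul_cancel (α s)) (velocity α s)).trans
    ((congrArg (fun w : EuclideanSpace ℝ (Fin 3) => g.inner ((α s)⁻¹ * α s)
      (w : TangentSpace (𝓡 3) ((α s)⁻¹ * α s)) (w : TangentSpace (𝓡 3) ((α s)⁻¹ * α s))) h2).trans h1)

/-- The left-translated velocity of a smooth curve is smooth. -/
lemma contDiffOn_velocity [LieGroup (𝓡 3) ∞ G] {J : Set ℝ}
    (hJ : IsOpen J) {α : ℝ → G} (hα : ContMDiffOn 𝓘(ℝ, ℝ) (𝓡 3) ∞ α J) :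
    ContDiffOn ℝ ∞ (F := EuclideanSpace ℝ (Fin 3)) (fun s => velocity α s) J := by
  intro s hs
  -- The velocity is the `t`-derivative of `(x, t) ↦ (α x)⁻¹ * α t` on the diagonal, so joint
  -- smoothness of this map suffices.
  have h1 : ContMDiffAt (𝓘(ℝ, ℝ).prod 𝓘(ℝ, ℝ)) (𝓡 3) ∞
      (Function.uncurry fun x t : ℝ => (α x)⁻¹ * α t) (s, s) := by
    have h2 := hα.contMDiffAt (hJ.mem_nhds hs)
    exact (ContMDiffAt.comp (s, s) h2 contMDiffAt_fst).inv.mul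
      (ContMDiffAt.comp (s, s) h2 contMDiffAt_snd)
  have : IsManifold (𝓡 3) ∞ G := inferInstance
  have : IsManifold (𝓡 3) 1 G := IsManifold.of_le (n := ∞) (by exact_mod_cast le_top)
  have h3 := ContMDiffAt.mfderiv_apply (m := ∞) (fun x t : ℝ => (α x)⁻¹ * α t) id id
    (fun _ => (1 : ℝ)) h1 contMDiffAt_id contMDiffAt_id contMDiffAt_const (by simp)
  rw [contMDiffAt_iff_contDiffAt] at h3
  refine (h3.congr_of_eventuallyEq (Filter.Eventually.of_forall fun x => ?_)).contDiffWithinAt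
  exact (inTangentCoordinates_apply_of_const (fun x => inv_mul_cancel (α x)) _ _ _ _).symm

/-- Removes the connection term from `D_T T`. -/
lemma bracket_self (v : GroupLieAlgebra (𝓡 3) G) : ⁅v, v⁆ = 0 := by
  rw [GroupLieAlgebra.bracket_def, VectorField.mlieBracket_self]
  rfl

/-- The Frenet apparatus in left-invariant coefficients satisfies the Euclidean Frenet equations,
with the modified torsion in place of the torsion. -/
lemma IsFrenetApparatus.frenetFrame [LieGroup (𝓡 3) ∞ G] {g : Metric G} (hg : IsBiInvariant g)
    {o : Orientation ℝ (GroupLieAlgebra (𝓡 3) G) (Fin 3)} {J : Set ℝ} (hJ : IsOpen J)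
    {α : ℝ → G} {T N B : ℝ → GroupLieAlgebra (𝓡 3) G} {κ τ : ℝ → ℝ} (hα : IsUnitSpeedOn g J α)
    (hF : IsFrenetApparatus g o J α T N B κ τ) :
    FrenetFrame (V := EuclideanSpace ℝ (Fin 3)) (g.inner 1) o J T N B κ
      (modTorsion g T N B τ) := by
  have hcov : ∀ s ∈ J, covDeriv α T s = deriv T s := fun s hs => by
    rw [covDeriv, hF.tangent s hs, bracket_self, smul_zero, add_zero]
  refine FrenetFrame.of_unit_tangent (V := EuclideanSpace ℝ (Fin 3)) (g.symm 1) hJ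
    ((contDiffOn_velocity hJ hα.smooth).congr hF.tangent) (fun s hs => ?_) (fun s hs => ?_)
    hF.curvature_pos (fun s hs => ?_) hF.binormal_unit (fun s hs => (hF.binormal_orth s hs).1)
    (fun s hs => (hF.binormal_orth s hs).2) hF.oriented (fun s hs => ?_)
  · rw [hF.tangent s hs]
    exact ip_velocity_self hg hJ hα hs
  · have := hF.curvature s hs
    rw [hcov s hs] at this
    exact this
  · exact (hcov s hs).symm.trans (hF.normal s hs)
  · have h1 : ip g (covDeriv α N s) (B s) = ip g (deriv N s) (B s) + tauG g T N B s := by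
      rw [covDeriv, tauG, hF.tangent s hs]
      simp only [ip, map_add, map_smul]
      rfl
    rw [modTorsion, hF.torsion s hs, h1, add_sub_cancel_right]
    rfl

end LieBertrand

theorem theorem3p1 {G : Type*} [TopologicalSpace G]
    [ChartedSpace (EuclideanSpace ℝ (Fin 3)) G] [Group G] [LieGroup (𝓡 3) ∞ G]
    (g : LieBertrand.Metric G) (hg : LieBertrand.IsBiInvariant g)
    (o : Orientation ℝ (GroupLieAlgebra (𝓡 3) G) (Fin 3))
    (J J₁ : Set ℝ) (hJ : IsOpen J) (hJc : J.OrdConnected) (hJ₁ : IsOpen J₁)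
    (hJc₁ : J₁.OrdConnected)
    (α α₁ : ℝ → G) (T N B T₁ N₁ B₁ : ℝ → GroupLieAlgebra (𝓡 3) G) (κ τ κ₁ τ₁ : ℝ → ℝ)
    (h : ℝ → ℝ)
    (hα : LieBertrand.IsUnitSpeedOn g J α) (hα₁ : LieBertrand.IsUnitSpeedOn g J₁ α₁)
    (hF : LieBertrand.IsFrenetApparatus g o J α T N B κ τ)
    (hF₁ : LieBertrand.IsFrenetApparatus g o J₁ α₁ T₁ N₁ B₁ κ₁ τ₁)
    (hpair : LieBertrand.IsBertrandPair J J₁ α α₁ N N₁ h) :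
    ∃ ε δ : ℝ, (ε = 1 ∨ ε = -1) ∧ (δ = 1 ∨ δ = -1) ∧
      (∀ s ∈ J, N s = ε • N₁ (h s)) ∧
      ∀ s ∈ J, deriv κ₁ (h s) ≠ 0 →
        let ρ := LieBertrand.rho g T₁ N₁ B₁ κ₁ τ₁ (h s)
        let H₁ := LieBertrand.harmonicCurvature g T₁ N₁ B₁ κ₁ τ₁ (h s)
        T s = (-δ / Real.sqrt (1 + ρ ^ 2)) • (T₁ (h s) - ρ • B₁ (h s)) ∧
        B s = (-(δ * ε) / Real.sqrt (1 + ρ ^ 2)) • (ρ • T₁ (h s) + B₁ (h s)) ∧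
        (δ = 1 ↔ LieBertrand.ip g (T s) (T₁ (h s)) < 0) ∧
        (H₁ ≠ 0 →
          deriv h s = δ * ((ρ - H₁) / (H₁ * Real.sqrt (1 + ρ ^ 2))) ∧
          κ s = -ε * κ₁ (h s) * (1 + H₁ * ρ) * (ρ - H₁) / (H₁ * (1 + ρ ^ 2)) ∧
          LieBertrand.modTorsion g T N B τ s
            = κ₁ (h s) * (ρ - H₁) ^ 2 / (H₁ * (1 + ρ ^ 2))) := by
  obtain ⟨hh, hbij, a, a₁, ha, ha₁, hline, hne⟩ := hpair
  have h1 := hF.frenetFrame hg hJ hα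
  have h2 := hF₁.frenetFrame hg hJ₁ hα₁
  obtain ⟨ε, δ, hε, hδ, hN, H⟩ := LieBertrand.FrenetFrame.bertrand
    (V := EuclideanSpace ℝ (Fin 3)) h1 h2 (g.symm 1) hJ hJc hJ₁ hbij.mapsTo hbij.surjOn
    (fun s hs => ((hh.contDiffAt (hJ.mem_nhds hs)).differentiableAt (by simp)).hasDerivAt)
    (a := a) (a₁ := a₁)
    (fun s hs => (hF.tangent s hs).symm ▸ ha s hs)
    (fun s hs => (hF₁.tangent s hs).symm ▸ ha₁ s hs) hline hne
  exact ⟨ε, δ, hε, hδ, hN, fun s hs hκ => H s hs hκ _ _ rfl rfl⟩
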